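/- Let $n\ge 1$, $p\ge 2$, and let $h\in C^2(\mathbb R^n)$ be nonnegative and positively homogeneous of degree $p$, with $D^2h(x)$ positive definite for every $x$ with $|x|=1$. Let $T:\mathbb R^n\to\mathcal P(\mathbb R^n)$ be an $h$-monotone multivalued map, i.e. $$h(x-\xi)+h(y-\zeta)\le h(x-\zeta)+h(y-\xi)\qquad\text{for all }x,y\in\mathbb R^n,\ \xi\in T(x),\ \zeta\in T(y).$$ Suppose that $T$ belongs to $L^{p-1}_{\rm loc}(\mathbb R^n)$, in the sense that $T(x)\ne\emptyset$ for a.e. $x$ and $T$ has an a.e. selection $x\mapsto Tx$ (that is, $Tx\in T(x)$ for a.e. $x$) in $L^{p-1}_{\rm loc}(\mathbb R^n;\mathbb R^n)$; fix such a selection. Let $E\subset\mathbb R^n$ be a measurable set such that for every $x_0\in E$ there is a vector $b=b_{x_0}\in\mathbb R^n$ with $$\Big(\frac1{|B_R(x_0)|}\int_{B_R(x_0)}|Tx-b|^{p-1}\,dx\Big)^{1/(p-1)}=O(R)\quad\text{as }R\to0^+ .$$ Then for almost every $x_0\in E$ there is a matrix $A=A_{x_0}\in\mathbb R^{n\times n}$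 such that $$\|Tx-A(x-x_0)-Tx_0\|_{L^\infty(B_R(x_0))}=o(R)\quad\text{as }R\to0^+,$$ and $T$ is differentiable at $x_0$ in the ordinary sense with derivative $A$: $T(x_0)=\{Tx_0\}$ and $$\sup_{\xi\in T(x)}|\xi-Tx_0-A(x-x_0)|=o(|x-x_0|)\quad\text{as }x\to x_0,\ x\in\operatorname{dom}(T)=\{x: T(x)\neq\emptyset\}.$$ -/

import Mathlib

open MeasureTheory Filter Topology
open scoped ENNReal

/-- The admissible costs: `h ∈ C²(ℝⁿ)` is nonnegative, positively homogeneous of degree `p ≥ 2`,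
and its Hessian is positive definite at every point of the unit sphere. -/
structure IsAdmissibleCost {n : ℕ} (p : ℝ) (h : EuclideanSpace ℝ (Fin n) → ℝ) : Prop where
  two_le : 2 ≤ p
  contDiff : ContDiff ℝ 2 h
  nonneg : ∀ x, 0 ≤ h x
  homogeneous : ∀ t : ℝ, 0 < t → ∀ x, h (t • x) = t ^ p * h x
  hessian_pos : ∀ x, ‖x‖ = 1 → ∀ v, v ≠ 0 → 0 < fderiv ℝ (fderiv ℝ h) x v v

/-- `h`-monotonicity of a multivalued map `T : ℝⁿ → 𝒫(ℝⁿ)`; points with `T x = ∅` lie outside the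
domain of `T` and impose no condition. -/
def HMonotone {n : ℕ} (h : EuclideanSpace ℝ (Fin n) → ℝ)
    (T : EuclideanSpace ℝ (Fin n) → Set (EuclideanSpace ℝ (Fin n))) : Prop :=
  ∀ x y, ∀ ξ ∈ T x, ∀ ζ ∈ T y, h (x - ξ) + h (y - ζ) ≤ h (x - ζ) + h (y - ξ)

/-- `f` is an almost everywhere defined single-valued version of the multivalued map `T`. -/
def IsAESelection {n : ℕ} (f : EuclideanSpace ℝ (Fin n) → EuclideanSpace ℝ (Fin n))
    (T : EuclideanSpace ℝ (Fin n) → Set (EuclideanSpace ℝ (Fin n))) : Prop :=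
  ∀ᵐ x, f x ∈ T x

/-- `f ∈ L^q_loc(ℝⁿ)` for a real exponent `q`. -/
def MemLpLoc {n : ℕ} (q : ℝ) (f : EuclideanSpace ℝ (Fin n) → EuclideanSpace ℝ (Fin n)) : Prop :=
  ∀ K : Set (EuclideanSpace ℝ (Fin n)), IsCompact K →
    MemLp f (ENNReal.ofReal q) (volume.restrict K)

/-- The estimate defining the Calderón–Zygmund class `T^{1,q}(x₀)`, for a map in `L^q_loc`:
for some constant vector `b` (a polynomial map of degree `< 1`),
`(⨍_{B_R(x₀)} |f - b|^q)^{1/q} = O(R)` as `R → 0⁺`. -/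
def MemBigT {n : ℕ} (q : ℝ) (f : EuclideanSpace ℝ (Fin n) → EuclideanSpace ℝ (Fin n))
    (x₀ : EuclideanSpace ℝ (Fin n)) : Prop :=
  ∃ b : EuclideanSpace ℝ (Fin n),
    (fun R : ℝ => (⨍ x in Metric.ball x₀ R, ‖f x - b‖ ^ q) ^ (1 / q)) =O[𝓝[>] 0]
      (fun R : ℝ => R)

/-- `‖f(x) - A(x - x₀) - f(x₀)‖_{L^∞(B_R(x₀))} = o(R)` as `R → 0⁺`: the estimate of
`t^{1,∞}(x₀)` with the polynomial map of degree `≤ 1` given by `x ↦ A(x - x₀) + f(x₀)`. The norm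
is the essential supremum, with values in `[0, ∞]`. -/
def HasLInftyDerivAt {n : ℕ} (f : EuclideanSpace ℝ (Fin n) → EuclideanSpace ℝ (Fin n))
    (A : EuclideanSpace ℝ (Fin n) →L[ℝ] EuclideanSpace ℝ (Fin n))
    (x₀ : EuclideanSpace ℝ (Fin n)) : Prop :=
  ∀ ε : ℝ, 0 < ε → ∀ᶠ R : ℝ in 𝓝[>] 0,
    eLpNorm (fun x => f x - A (x - x₀) - f x₀) ∞ (volume.restrict (Metric.ball x₀ R)) ≤
      ENNReal.ofReal (ε * R)

/-- The multivalued map `T` is single-valued at `x₀`, with value `ξ₀`, and is differentiable there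
in the ordinary sense with derivative `A`: `ξ - ξ₀ - A(x - x₀) = o(|x - x₀|)` as `x → x₀`,
uniformly in the values `ξ ∈ T x`. -/
def HasMultiDerivAt {n : ℕ} (T : EuclideanSpace ℝ (Fin n) → Set (EuclideanSpace ℝ (Fin n)))
    (ξ₀ : EuclideanSpace ℝ (Fin n))
    (A : EuclideanSpace ℝ (Fin n) →L[ℝ] EuclideanSpace ℝ (Fin n))
    (x₀ : EuclideanSpace ℝ (Fin n)) : Prop :=
  T x₀ = {ξ₀} ∧
    ∀ ε : ℝ, 0 < ε → ∀ᶠ x in 𝓝 x₀, ∀ ξ ∈ T x, ‖ξ - ξ₀ - A (x - x₀)‖ ≤ ε * ‖x - x₀‖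

/-! Monotonicity upgrades the averaged bound at a point of `E` to a pointwise bound on every value
of `T` nearby; a Stepanov argument then gives differentiability almost everywhere. For the upgrade,
let `ξ ∈ T x` with `v = ξ - b` large compared with `r`. By Chebyshev some `y` near `x + (r/‖v‖)v`
has `‖f y - b‖ ≤ C r`. Monotonicity for the pair `x, y` compares two integrals of `D²h(x - y, ·)`
along segments starting at `b`, ending at `ξ` and at `f y`. As `x - y` is almost antiparallel to
`v`, ellipticity bounds the first below by a multiple of `r‖v‖` and the second above by a multiple
of `r‖f y - b‖`, with weights `|·|^(p-2)`. Once these degenerate weights are comparable, `‖v‖ ≤ K r`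
follows (`exists_linear_bound_of_memBigT`). Letting `r → 0` forces `T x₀ = {b}`, so `T` is Lipschitz
at `x₀`. -/

/-! ### Homogeneity and two-sided Hessian bounds -/

theorem fderiv_smul_of_homogeneous {E F : Type*} [NormedAddCommGroup E] [NormedSpace ℝ E]
    [NormedAddCommGroup F] [NormedSpace ℝ F] {g : E → F} {q : ℝ} (hg : Differentiable ℝ g)
    (hom : ∀ t : ℝ, 0 < t → ∀ x, g (t • x) = t ^ q • g x) (t : ℝ) (ht : 0 < t) (x : E) :
    fderiv ℝ g (t • x) = t ^ (q - 1) • fderiv ℝ g x := by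
  have h1 : HasFDerivAt (fun x => g (t • x))
      ((fderiv ℝ g (t • x)).comp (t • ContinuousLinearMap.id ℝ E)) x :=
    HasFDerivAt.comp x (hg (t • x)).hasFDerivAt ((hasFDerivAt_id x).const_smul t)
  have h2 : HasFDerivAt (fun x => g (t • x)) (t ^ q • fderiv ℝ g x) x := by
    simp_rw [hom t ht]
    exact (hg x).hasFDerivAt.const_smul _
  have h3 := h1.unique h2
  have h4 : t • fderiv ℝ g (t • x) = t ^ q • fderiv ℝ g x := by
    rw [← h3]; ext v; simp
  rw [Real.rpow_sub_one ht.ne', div_eq_inv_mul, mul_smul, ← h4, smul_smul, inv_mul_cancel₀ ht.ne',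
    one_smul]

namespace IsAdmissibleCost

variable {n : ℕ} {p : ℝ} {h : EuclideanSpace ℝ (Fin n) → ℝ}

theorem contDiff_fderiv (hh : IsAdmissibleCost p h) : ContDiff ℝ 1 (fderiv ℝ h) :=
  hh.contDiff.fderiv_right (by norm_num)

theorem continuous_hessian (hh : IsAdmissibleCost p h) :
    Continuous (fderiv ℝ (fderiv ℝ h)) :=
  hh.contDiff_fderiv.continuous_fderiv (by norm_num)

theorem hessian_smul (hh : IsAdmissibleCost p h) (t : ℝ) (ht : 0 < t)
    (x : EuclideanSpace ℝ (Fin n)) :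
    fderiv ℝ (fderiv ℝ h) (t • x) = t ^ (p - 2) • fderiv ℝ (fderiv ℝ h) x := by
  have h1 := fderiv_smul_of_homogeneous (hh.contDiff.differentiable (by norm_num))
    (q := p) (by simpa using hh.homogeneous)
  have h2 := fderiv_smul_of_homogeneous (hh.contDiff_fderiv.differentiable (by norm_num)) h1 t ht x
  rw [h2]; congr 2; ring

/-- Compactness gives the bounds on the unit sphere, and the Hessian is homogeneous of degree `p -
2`. -/
theorem exists_hessian_bounds (hh : IsAdmissibleCost p h) :
    ∃ l L : ℝ, 0 < l ∧ 0 < L ∧ ∀ w v e : EuclideanSpace ℝ (Fin n),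
      l * ‖w‖ ^ (p - 2) * ‖v‖ ^ 2 ≤ fderiv ℝ (fderiv ℝ h) w v v ∧
      |fderiv ℝ (fderiv ℝ h) w e v| ≤ L * ‖w‖ ^ (p - 2) * ‖e‖ * ‖v‖ := by
  set H := fderiv ℝ (fderiv ℝ h) with hH
  have hc : Continuous H := hh.continuous_hessian
  have hS : IsCompact (Metric.sphere (0 : EuclideanSpace ℝ (Fin n)) 1) := isCompact_sphere _ _
  have hn : Continuous fun x => ‖H x‖ :=
    Continuous.norm
      (E := EuclideanSpace ℝ (Fin n) →L[ℝ] EuclideanSpace ℝ (Fin n) →L[ℝ] ℝ) hc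
  obtain ⟨L, hL⟩ := hS.bddAbove_image hn.continuousOn
  replace hL : ∀ x ∈ Metric.sphere 0 1, ‖H x‖ ≤ L := fun x hx => hL ⟨x, hx, rfl⟩
  obtain ⟨l, hl0, hl⟩ := (hS.prod hS).exists_forall_le'
      (f := fun z => H z.1 z.2 z.2) (a := 0)
      (by fun_prop) (by
        rintro ⟨x, v⟩ ⟨hx, hv⟩
        simp only [mem_sphere_zero_iff_norm] at hx hv
        exact hh.hessian_pos x hx v (by rintro rfl; simp at hv))
  refine ⟨l, max L 1, hl0, by positivity, ?_⟩
  have unit_bounds : ∀ u v e : EuclideanSpace ℝ (Fin n), ‖u‖ = 1 →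
      l * ‖v‖ ^ 2 ≤ H u v v ∧ |H u e v| ≤ max L 1 * ‖e‖ * ‖v‖ := by
    intro u v e hu
    constructor
    · rcases eq_or_ne v 0 with rfl | hv
      · simp
      · have hv' : 0 < ‖v‖ := norm_pos_iff.2 hv
        have := hl (u, ‖v‖⁻¹ • v) ⟨by simpa using hu, by
          simp [norm_smul, inv_mul_cancel₀ hv'.ne']⟩
        simp only [map_smul, _root_.smul_apply, smul_eq_mul] at this
        rw [← mul_assoc, ← mul_inv, inv_mul_eq_div, le_div_iff₀ (by positivity)] at this
        rwa [sq]
    · have h1 := (H u).le_opNorm₂ e v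
      have h2 := hL u (by simpa using hu)
      rw [Real.norm_eq_abs] at h1
      refine h1.trans ?_
      gcongr
      exact h2.trans (le_max_left _ _)
  have nonzero_bounds : ∀ w v e : EuclideanSpace ℝ (Fin n), w ≠ 0 →
      l * ‖w‖ ^ (p - 2) * ‖v‖ ^ 2 ≤ H w v v ∧
        |H w e v| ≤ max L 1 * ‖w‖ ^ (p - 2) * ‖e‖ * ‖v‖ := by
    intro w v e hw
    have hw' : 0 < ‖w‖ := norm_pos_iff.2 hw
    obtain ⟨h1, h2⟩ := unit_bounds (‖w‖⁻¹ • w) v e (by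
      simp [norm_smul, inv_mul_cancel₀ hw'.ne'])
    have h3 : H w = ‖w‖ ^ (p - 2) • H (‖w‖⁻¹ • w) := by
      rw [hH, ← hh.hessian_smul _ hw', smul_smul, mul_inv_cancel₀ hw'.ne', one_smul]
    have h4 : 0 < ‖w‖ ^ (p - 2) := Real.rpow_pos_of_pos hw' _
    simp only [h3, _root_.smul_apply, smul_eq_mul, abs_mul, abs_of_pos h4]
    constructor
    · calc _ = ‖w‖ ^ (p - 2) * (l * ‖v‖ ^ 2) := by ring
        _ ≤ _ := by gcongr
    · calc _ ≤ ‖w‖ ^ (p - 2) * (max L 1 * ‖e‖ * ‖v‖) := by gcongr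
        _ = _ := by ring
  intro w v e
  rcases subsingleton_or_nontrivial (EuclideanSpace ℝ (Fin n)) with hs | hs
  · simp [Subsingleton.elim v 0]
  -- The origin is reached by density; for `p = 2` the weight there is `0 ^ 0 = 1`, so the bounds
  -- are not vacuous.
  have hpow : Continuous fun w : EuclideanSpace ℝ (Fin n) => ‖w‖ ^ (p - 2) :=
    continuous_norm.rpow_const fun _ => Or.inr (sub_nonneg.2 hh.two_le)
  have hcl : IsClosed {w : EuclideanSpace ℝ (Fin n) | l * ‖w‖ ^ (p - 2) * ‖v‖ ^ 2 ≤ H w v v ∧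
        |H w e v| ≤ max L 1 * ‖w‖ ^ (p - 2) * ‖e‖ * ‖v‖} :=
by
    have hHe : ∀ e : EuclideanSpace ℝ (Fin n), Continuous fun w => H w e v := fun e =>
      (hc.clm_apply continuous_const).clm_apply continuous_const
    have hHv : Continuous fun w => H w v v :=
      (hc.clm_apply continuous_const).clm_apply continuous_const
    rw [Set.ofPred_and]
    exact (isClosed_le ((continuous_const.mul hpow).mul continuous_const) hHv).inter
      (isClosed_le (hHe e).abs
        (((continuous_const.mul hpow).mul continuous_const).mul continuous_const))
  exact hcl.closure_subset_iff.2 (fun w hw => nonzero_bounds w v e hw)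
    ((dense_compl_singleton (0 : EuclideanSpace ℝ (Fin n))) w)

end IsAdmissibleCost

/-! ### Comparison of two values through monotonicity -/

theorem hasDerivAt_apply_add_smul {E : Type*} [NormedAddCommGroup E] [NormedSpace ℝ E]
    {G : E → E →L[ℝ] ℝ} (hG : Differentiable ℝ G) (c d v : E) (s : ℝ) :
    HasDerivAt (fun s : ℝ => G (c + s • d) v) (fderiv ℝ G (c + s • d) d v) s := by
  have h1 : HasDerivAt (fun s : ℝ => c + s • d) d s := by
    simpa using ((hasDerivAt_id s).smul_const d).const_add c
  have h2 := (hG (c + s • d)).hasFDerivAt.comp_hasDerivAt s h1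
  simpa using h2.clm_apply (hasDerivAt_const s v)

theorem hasDerivAt_increment {E : Type*} [NormedAddCommGroup E] [NormedSpace ℝ E]
    {h : E → ℝ} (hd : Differentiable ℝ h) (a d v : E) (t : ℝ) :
    HasDerivAt (fun t : ℝ => h (a - t • v + d) - h (a - t • v))
      (fderiv ℝ h (a - t • v) v - fderiv ℝ h (a - t • v + d) v) t := by
  have h1 : HasDerivAt (fun t : ℝ => a - t • v) (-v) t := by
    simpa using ((hasDerivAt_id t).smul_const v).const_sub a
  have h2 := (hd (a - t • v + d)).hasFDerivAt.comp_hasDerivAt t (h1.add_const d)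
  have h3 := (hd (a - t • v)).hasFDerivAt.comp_hasDerivAt t h1
  have h4 := h2.sub h3
  rw [map_neg, map_neg, neg_sub_neg] at h4
  exact h4

namespace IsAdmissibleCost

variable {n : ℕ} {p : ℝ} {h : EuclideanSpace ℝ (Fin n) → ℝ}

theorem exists_fderiv_sub_eq_hessian (hh : IsAdmissibleCost p h)
    (c d v : EuclideanSpace ℝ (Fin n)) : ∃ s ∈ Set.Ioo (0 : ℝ) 1,
      fderiv ℝ h (c + d) v - fderiv ℝ h c v = fderiv ℝ (fderiv ℝ h) (c + s • d) d v := by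
  have hderiv := hasDerivAt_apply_add_smul (hh.contDiff_fderiv.differentiable (by norm_num)) c d v
  obtain ⟨s, hs, h1⟩ := exists_hasDerivAt_eq_slope _ _ one_pos
    (fun s _ => (hderiv s).continuousAt.continuousWithinAt) (fun s _ => hderiv s)
  exact ⟨s, hs, by simpa using h1.symm⟩

/-- Up to an error of size `δ r`, `d` is `-(r/‖v‖)v`. The main part contributes at least `l r ‖v‖`
times the weight, and `L δ ≤ l / 2` lets the error absorb at most half of it. -/
theorem fderiv_sub_lower_bound (hh : IsAdmissibleCost p h) {l L : ℝ}
    (hb : ∀ w v e : EuclideanSpace ℝ (Fin n),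
      l * ‖w‖ ^ (p - 2) * ‖v‖ ^ 2 ≤ fderiv ℝ (fderiv ℝ h) w v v ∧
      |fderiv ℝ (fderiv ℝ h) w e v| ≤ L * ‖w‖ ^ (p - 2) * ‖e‖ * ‖v‖)
    (hl : 0 < l) (hL : 0 < L) {δ r m : ℝ} (hδ : L * δ ≤ l / 2) (hr : 0 < r) (hm : 0 ≤ m)
    {c d v : EuclideanSpace ℝ (Fin n)} (hv : v ≠ 0) (hd : ‖d + (r / ‖v‖) • v‖ ≤ δ * r)
    (hmc : ∀ s ∈ Set.Icc (0 : ℝ) 1, m ≤ ‖c + s • d‖) :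
    l / 2 * r * ‖v‖ * m ^ (p - 2) ≤ fderiv ℝ h c v - fderiv ℝ h (c + d) v := by
  obtain ⟨s, hs, h1⟩ := hh.exists_fderiv_sub_eq_hessian c d v
  set w := c + s • d
  set e := d + (r / ‖v‖) • v with he
  have hv' : 0 < ‖v‖ := norm_pos_iff.2 hv
  have hd' : d = e - (r / ‖v‖) • v := by rw [he]; abel
  have hmw : m ^ (p - 2) ≤ ‖w‖ ^ (p - 2) :=
    Real.rpow_le_rpow hm (hmc s ⟨hs.1.le, hs.2.le⟩) (sub_nonneg.2 hh.two_le)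
  have hw0 : 0 ≤ ‖w‖ ^ (p - 2) := by positivity
  have h2 : fderiv ℝ (fderiv ℝ h) w d v = fderiv ℝ (fderiv ℝ h) w e v
      - (r / ‖v‖) * fderiv ℝ (fderiv ℝ h) w v v := by
    conv_lhs => rw [hd']
    simp
  have h3 : fderiv ℝ (fderiv ℝ h) w e v ≤ l / 2 * r * ‖v‖ * ‖w‖ ^ (p - 2) := by
    calc _ ≤ L * ‖w‖ ^ (p - 2) * ‖e‖ * ‖v‖ := (le_abs_self _).trans (hb w v e).2
      _ ≤ L * ‖w‖ ^ (p - 2) * (δ * r) * ‖v‖ := by gcongr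
      _ = (L * δ) * (r * ‖v‖ * ‖w‖ ^ (p - 2)) := by ring
      _ ≤ (l / 2) * (r * ‖v‖ * ‖w‖ ^ (p - 2)) := by gcongr
      _ = _ := by ring
  have h4 : l * r * ‖v‖ * ‖w‖ ^ (p - 2) ≤ (r / ‖v‖) * fderiv ℝ (fderiv ℝ h) w v v := by
    calc _ = (r / ‖v‖) * (l * ‖w‖ ^ (p - 2) * ‖v‖ ^ 2) := by field_simp
      _ ≤ _ := by gcongr; exact (hb w v e).1
  have h5 : l / 2 * r * ‖v‖ * m ^ (p - 2) ≤ l / 2 * r * ‖v‖ * ‖w‖ ^ (p - 2) := by gcongr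
  linarith

theorem abs_fderiv_sub_le (hh : IsAdmissibleCost p h) {L : ℝ}
    (hb : ∀ w v e : EuclideanSpace ℝ (Fin n),
      |fderiv ℝ (fderiv ℝ h) w e v| ≤ L * ‖w‖ ^ (p - 2) * ‖e‖ * ‖v‖) (hL : 0 < L) {M : ℝ}
    {c d v : EuclideanSpace ℝ (Fin n)} (hM : ∀ s ∈ Set.Icc (0 : ℝ) 1, ‖c + s • d‖ ≤ M) :
    |fderiv ℝ h (c + d) v - fderiv ℝ h c v| ≤ L * M ^ (p - 2) * ‖d‖ * ‖v‖ := by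
  obtain ⟨s, hs, h1⟩ := hh.exists_fderiv_sub_eq_hessian c d v
  rw [h1]
  refine (hb _ v d).trans ?_
  gcongr
  · exact sub_nonneg.2 hh.two_le
  · exact hM s ⟨hs.1.le, hs.2.le⟩

/-- Comparison of two values of an `h`-monotone map at points whose difference is nearly
antiparallel to `ξ - b`. -/
theorem norm_mul_rpow_le_of_hMonotone (hh : IsAdmissibleCost p h) {l L : ℝ}
    (hb : ∀ w v e : EuclideanSpace ℝ (Fin n),
      l * ‖w‖ ^ (p - 2) * ‖v‖ ^ 2 ≤ fderiv ℝ (fderiv ℝ h) w v v ∧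
      |fderiv ℝ (fderiv ℝ h) w e v| ≤ L * ‖w‖ ^ (p - 2) * ‖e‖ * ‖v‖)
    (hl : 0 < l) (hL : 0 < L) {δ r m M t₀ : ℝ} (hδ : L * δ ≤ l / 2) (hδ1 : δ ≤ 1)
    (hr : 0 < r) (hm : 0 ≤ m) (hM : 0 ≤ M) (ht₀ : 0 ≤ t₀) (ht₁ : t₀ + 1 / 4 ≤ 1)
    {x y ξ ζ b : EuclideanSpace ℝ (Fin n)}
    (hmon : h (x - ξ) + h (y - ζ) ≤ h (x - ζ) + h (y - ξ)) (hv : ξ - b ≠ 0)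
    (hd : ‖x - y + (r / ‖ξ - b‖) • (ξ - b)‖ ≤ δ * r)
    (hmc : ∀ t ∈ Set.Icc t₀ (t₀ + 1 / 4), ∀ s ∈ Set.Icc (0 : ℝ) 1,
      m ≤ ‖y - b - t • (ξ - b) + s • (x - y)‖)
    (hMc : ∀ t ∈ Set.Icc (0 : ℝ) 1, ∀ s ∈ Set.Icc (0 : ℝ) 1,
      ‖y - b - t • (ζ - b) + s • (x - y)‖ ≤ M) :
    l * ‖ξ - b‖ * m ^ (p - 2) ≤ 16 * L * ‖ζ - b‖ * M ^ (p - 2) := by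
  set v := ξ - b with hv_def
  set u := ζ - b with hu_def
  set d := x - y with hd_def
  have hv' : 0 < ‖v‖ := norm_pos_iff.2 hv
  have hd2 : ‖d‖ ≤ 2 * r := by
    have h1 : d = (d + (r / ‖v‖) • v) - (r / ‖v‖) • v := by abel
    have h2 : ‖(r / ‖v‖) • v‖ = r := by
      rw [norm_smul, Real.norm_of_nonneg (by positivity), div_mul_cancel₀ _ hv'.ne']
    rw [h1]
    refine (norm_sub_le _ _).trans ?_
    rw [h2]
    nlinarith
  -- For `v` and `u` these functions agree at `t = 0`, and their values at `t = 1` are the two sides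
  -- of `h(x - ξ) - h(y - ξ) ≤ h(x - ζ) - h(y - ζ)`.
  have hψ := hasDerivAt_increment (hh.contDiff.differentiable (by norm_num)) (y - b) d v
  have hΨ := hasDerivAt_increment (hh.contDiff.differentiable (by norm_num)) (y - b) d u
  have hcont : ∀ D : Set ℝ, ContinuousOn
      (fun t : ℝ => h (y - b - t • v + d) - h (y - b - t • v)) D :=
    fun D t _ => (hψ t).continuousAt.continuousWithinAt
  have hdiff : ∀ D : Set ℝ, DifferentiableOn ℝ
      (fun t : ℝ => h (y - b - t • v + d) - h (y - b - t • v)) D :=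
    fun D t _ => (hψ t).differentiableAt.differentiableWithinAt
  -- With `m = 0` the lower bound still gives monotonicity, so nothing is lost outside the quarter
  -- interval.
  have hmono := monotoneOn_of_deriv_nonneg (convex_Icc (0 : ℝ) 1) (hcont _) (hdiff _) (by
    intro t _
    rw [(hψ t).deriv]
    refine le_trans ?_ (hh.fderiv_sub_lower_bound hb hl hL hδ hr le_rfl hv hd
      (fun s _ => norm_nonneg _))
    positivity)
  have hquarter := (convex_Icc t₀ (t₀ + 1 / 4)).mul_sub_le_image_sub_of_le_deriv (hcont _)
    (hdiff _) (C := l / 2 * r * ‖v‖ * m ^ (p - 2)) (by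
      intro t ht
      rw [(hψ t).deriv]
      exact hh.fderiv_sub_lower_bound hb hl hL hδ hr hm hv hd (hmc t (interior_subset ht)))
    t₀ ⟨le_rfl, by linarith⟩ (t₀ + 1 / 4) ⟨by linarith, le_rfl⟩ (by linarith)
  have hlow := hmono ⟨le_rfl, zero_le_one⟩ ⟨ht₀, by linarith⟩ ht₀
  have hhigh := hmono (a := t₀ + 1 / 4) (b := 1) ⟨by linarith, ht₁⟩ ⟨zero_le_one, le_rfl⟩ ht₁
  have hup := norm_image_sub_le_of_norm_deriv_le_segment_01'
    (C := L * M ^ (p - 2) * (2 * r) * ‖u‖)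
    (fun t _ => (hΨ t).hasDerivWithinAt) (by
      intro t ht
      rw [Real.norm_eq_abs, abs_sub_comm]
      refine (hh.abs_fderiv_sub_le (fun w v e => (hb w v e).2) hL
        (hMc t ⟨ht.1, ht.2.le⟩)).trans ?_
      gcongr)
  have hup' := (le_abs_self _).trans hup
  have e1 : y - ξ + d = x - ξ := by rw [hd_def]; abel
  have e2 : y - b - (1 : ℝ) • v = y - ξ := by rw [hv_def, one_smul]; abel
  have e3 : y - ζ + d = x - ζ := by rw [hd_def]; abel
  have e4 : y - b - (1 : ℝ) • u = y - ζ := by rw [hu_def, one_smul]; abel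
  simp only [e1, e2, e3, e4, zero_smul, sub_zero] at hlow hhigh hup'
  have hfin : r * (l * ‖v‖ * m ^ (p - 2)) ≤ r * (16 * L * ‖u‖ * M ^ (p - 2)) := by
    linarith
  exact le_of_mul_le_mul_left hfin hr

end IsAdmissibleCost

/-! ### From averaged to pointwise bounds -/

theorem exists_mem_ball_norm_sub_le {n : ℕ} {q : ℝ} (hq : 1 ≤ q)
    {T : EuclideanSpace ℝ (Fin n) → Set (EuclideanSpace ℝ (Fin n))}
    {f : EuclideanSpace ℝ (Fin n) → EuclideanSpace ℝ (Fin n)} (hf : IsAESelection f T)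
    (hfL : MemLpLoc q f) {x₀ b : EuclideanSpace ℝ (Fin n)}
    (hO : (fun R : ℝ => (⨍ x in Metric.ball x₀ R, ‖f x - b‖ ^ q) ^ (1 / q)) =O[𝓝[>] 0]
      (fun R : ℝ => R)) {δ : ℝ} (hδ : 0 < δ) (hδ1 : δ ≤ 1) :
    ∃ C r₁ : ℝ, 0 < C ∧ 0 < r₁ ∧ ∀ r, 0 < r → r < r₁ → ∀ z, ‖z - x₀‖ ≤ 2 * r →
      ∃ y ∈ Metric.ball z (δ * r), f y ∈ T y ∧ ‖f y - b‖ ≤ C * r := by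
  have hq0 : 0 < q := by linarith
  obtain ⟨c, hc, hO⟩ := hO.exists_pos
  have hO := hO.bound
  rw [eventually_nhdsWithin_iff, Metric.eventually_nhds_iff] at hO
  obtain ⟨R₀, hR₀, hO⟩ := hO
  -- One more than the volume ratio of `B_{3r}` to `B_{δr}`: if no good point existed, the average
  -- bound would give `Q ^ q ≤ Q - 1`, while `Q ≤ Q ^ q`.
  set Q : ℝ := (3 / δ) ^ n + 1 with hQ
  have hQ0 : 0 < (3 / δ) ^ n := by positivity
  refine ⟨Q * (3 * c), R₀ / 3, by positivity, by positivity, fun r hr hr1 z hz => ?_⟩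
  set R := 3 * r with hR
  have hRpos : 0 < R := by positivity
  by_contra! hcon
  have hsub : Metric.ball z (δ * r) ⊆ Metric.ball x₀ R := by
    refine Metric.ball_subset_ball' ?_
    rw [dist_eq_norm]
    nlinarith
  have hint : IntegrableOn (fun x => ‖f x - b‖ ^ q) (Metric.ball x₀ R) := by
    have h1 : MemLp f (ENNReal.ofReal q) (volume.restrict (Metric.ball x₀ R)) :=
      (hfL _ (isCompact_closedBall x₀ R)).mono_measure
        (Measure.restrict_mono Metric.ball_subset_closedBall le_rfl)
    have : IsFiniteMeasure (volume.restrict (Metric.ball x₀ R)) :=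
      ⟨by simpa using measure_ball_lt_top⟩
    have h2 := (h1.sub (memLp_const b)).integrable_norm_rpow
      (by simpa using hq0) ENNReal.ofReal_ne_top
    rw [ENNReal.toReal_ofReal hq0.le] at h2
    exact h2
  have havg : (⨍ x in Metric.ball x₀ R, ‖f x - b‖ ^ q) ≤ (c * R) ^ q := by
    have h0 : 0 ≤ ⨍ x in Metric.ball x₀ R, ‖f x - b‖ ^ q := by
      rw [setAverage_eq]
      exact smul_nonneg (by positivity) (integral_nonneg fun x => by positivity)
    have h1 := hO (y := R) (by rw [Real.dist_eq, sub_zero, abs_of_pos hRpos]; linarith) hRpos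
    rw [Real.norm_of_nonneg (by positivity), Real.norm_of_nonneg hRpos.le] at h1
    have h2 := Real.rpow_le_rpow (by positivity) h1 hq0.le
    rwa [← Real.rpow_mul h0, one_div_mul_cancel hq0.ne', Real.rpow_one] at h2
  have hB : 0 < volume.real (Metric.ball x₀ R) :=
    ENNReal.toReal_pos (Metric.measure_ball_pos _ _ hRpos).ne' measure_ball_lt_top.ne
  have hB' : 0 < volume.real (Metric.ball z (δ * r)) :=
    ENNReal.toReal_pos (Metric.measure_ball_pos _ _ (by positivity)).ne' measure_ball_lt_top.ne
  have hvol : volume.real (Metric.ball x₀ R)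
      = (3 / δ) ^ n * volume.real (Metric.ball z (δ * r)) := by
    rw [Measure.real, Measure.real, Measure.addHaar_ball_of_pos _ _ hRpos,
      Measure.addHaar_ball_of_pos _ _ (by positivity : 0 < δ * r), ENNReal.toReal_mul,
      ENNReal.toReal_mul, ENNReal.toReal_ofReal (by positivity),
      ENNReal.toReal_ofReal (by positivity), finrank_euclideanSpace_fin, ← mul_assoc, ← mul_pow]
    congr 2
    rw [hR]; field_simp
  rw [setAverage_eq, smul_eq_mul, inv_mul_le_iff₀ hB] at havg
  have hlow : (Q * (3 * c) * r) ^ q * volume.real (Metric.ball z (δ * r))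
      ≤ ∫ x in Metric.ball z (δ * r), ‖f x - b‖ ^ q := by
    have h1 : ∫ _ in Metric.ball z (δ * r), (Q * (3 * c) * r) ^ q
        = (Q * (3 * c) * r) ^ q * volume.real (Metric.ball z (δ * r)) := by
      rw [setIntegral_const, smul_eq_mul, mul_comm]
    rw [← h1]
    refine integral_mono_ae (integrableOn_const measure_ball_lt_top.ne)
      (hint.mono_set hsub) ?_
    filter_upwards [ae_restrict_of_ae hf, ae_restrict_mem measurableSet_ball] with y hy hyB
    have := (hcon y hyB hy).le
    gcongr
  have hmono : ∫ x in Metric.ball z (δ * r), ‖f x - b‖ ^ q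
      ≤ ∫ x in Metric.ball x₀ R, ‖f x - b‖ ^ q :=
    setIntegral_mono_set hint (Eventually.of_forall fun x => by positivity)
      hsub.eventuallyLE
  have h1 : (Q * (3 * c) * r) ^ q ≤ (3 / δ) ^ n * (c * R) ^ q := by
    refine le_of_mul_le_mul_right ?_ hB'
    calc _ ≤ _ := hlow.trans (hmono.trans havg)
      _ = _ := by rw [hvol]; ring
  have h2 : Q * (3 * c) * r = Q * (c * R) := by rw [hR]; ring
  rw [h2, Real.mul_rpow (by positivity) (by positivity)] at h1
  have h3 : Q ≤ Q ^ q := Real.self_le_rpow_of_one_le (by linarith) hq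
  have h4 : 0 < (c * R) ^ q := by positivity
  have h5 := le_of_mul_le_mul_right h1 h4
  linarith

theorem exists_linear_bound_of_memBigT {n : ℕ} {p : ℝ} {h : EuclideanSpace ℝ (Fin n) → ℝ}
    (hh : IsAdmissibleCost p h)
    {T : EuclideanSpace ℝ (Fin n) → Set (EuclideanSpace ℝ (Fin n))} (hT : HMonotone h T)
    {f : EuclideanSpace ℝ (Fin n) → EuclideanSpace ℝ (Fin n)} (hf : IsAESelection f T)
    (hfL : MemLpLoc (p - 1) f) {x₀ : EuclideanSpace ℝ (Fin n)} (hx₀ : MemBigT (p - 1) f x₀) :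
    ∃ (b : EuclideanSpace ℝ (Fin n)) (K r₀ : ℝ), 0 < r₀ ∧ ∀ r, 0 < r → r < r₀ →
      ∀ x, ‖x - x₀‖ ≤ r → ∀ ξ ∈ T x, ‖ξ - b‖ ≤ K * r := by
  obtain ⟨b, hb⟩ := hx₀
  obtain ⟨l, L, hl, hL, hHess⟩ := hh.exists_hessian_bounds
  obtain ⟨δ, hδ, hδ1, hδL⟩ : ∃ δ : ℝ, 0 < δ ∧ δ ≤ 1 ∧ L * δ ≤ l / 2 := by
    refine ⟨min 1 (l / 2 / L), by positivity, min_le_left _ _, ?_⟩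
    calc _ ≤ L * (l / 2 / L) := by gcongr; exact min_le_right _ _
      _ = _ := by field_simp
  obtain ⟨C, r₁, hC, hr₁, hgood⟩ :=
    exists_mem_ball_norm_sub_le (by linarith [hh.two_le]) hf hfL hb hδ hδ1
  set K₁ : ℝ := 16 * L * C * (4 * (5 + C)) ^ (p - 2) / l with hK₁
  set β := ‖x₀ - b‖ with hβ
  -- If `x₀ ≠ b`, perturbations of size `5 r` stay below `β / 4`.
  obtain ⟨r₀, hr₀, hr₀₁, hr₀β⟩ : ∃ r₀ : ℝ, 0 < r₀ ∧ r₀ ≤ r₁ ∧ (0 < β → r₀ ≤ β / 20) := by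
    rcases (norm_nonneg (x₀ - b)).eq_or_lt with h0 | h0
    · exact ⟨r₁, hr₁, le_rfl, fun h => absurd h (by rw [hβ, ← h0]; exact lt_irrefl _)⟩
    · exact ⟨min r₁ (β / 20), by positivity, min_le_left _ _, fun _ => min_le_right _ _⟩
  refine ⟨b, max 20 K₁, r₀, hr₀, fun r hr hrr₀ x hx ξ hξ => ?_⟩
  by_contra! hlt
  have hlt20 : 20 * r < ‖ξ - b‖ := lt_of_le_of_lt (by gcongr; exact le_max_left _ _) hlt
  have hltK : K₁ * r < ‖ξ - b‖ := lt_of_le_of_lt (by gcongr; exact le_max_right _ _) hlt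
  set v := ξ - b with hv_def
  have hv' : 0 < ‖v‖ := by linarith
  have hvr : ‖(r / ‖v‖) • v‖ = r := by
    rw [norm_smul, Real.norm_of_nonneg (by positivity), div_mul_cancel₀ _ hv'.ne']
  obtain ⟨y, hyB, hyT, hyb⟩ := hgood r hr (hrr₀.trans_le hr₀₁) (x + (r / ‖v‖) • v) (by
    rw [add_sub_right_comm]
    refine (norm_add_le _ _).trans ?_
    rw [hvr]; linarith)
  have hd : ‖x - y + (r / ‖v‖) • v‖ ≤ δ * r := by
    rw [Metric.mem_ball, dist_comm, dist_eq_norm] at hyB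
    rw [← add_sub_right_comm]; exact hyB.le
  have hδr : δ * r ≤ r := by nlinarith
  have hxy : ‖x - y‖ ≤ 2 * r := by
    have h1 : x - y = (x - y + (r / ‖v‖) • v) - (r / ‖v‖) • v := by abel
    rw [h1]
    refine (norm_sub_le _ _).trans ?_
    rw [hvr]; linarith
  have hyx₀ : ‖y - x₀‖ ≤ 3 * r := by
    have h1 : y - x₀ = (x - x₀) - (x - y) := by abel
    rw [h1]
    refine (norm_sub_le _ _).trans ?_
    linarith
  have hpert : ∀ s ∈ Set.Icc (0 : ℝ) 1, ‖(y - x₀) + s • (x - y)‖ ≤ 5 * r := by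
    intro s hs
    refine (norm_add_le _ _).trans ?_
    rw [norm_smul, Real.norm_of_nonneg hs.1]
    have : s * ‖x - y‖ ≤ 1 * ‖x - y‖ := by gcongr; exact hs.2
    linarith
  have hsplit : ∀ (t s : ℝ) (w : EuclideanSpace ℝ (Fin n)),
      y - b - t • w + s • (x - y) = ((y - x₀) + s • (x - y)) + ((x₀ - b) - t • w) := by
    intro t s w; abel
  have hlow_far : ∀ t ∈ Set.Icc (3 / 4 : ℝ) (3 / 4 + 1 / 4), ∀ s ∈ Set.Icc (0 : ℝ) 1,
      3 / 4 * ‖v‖ - β - 5 * r ≤ ‖y - b - t • v + s • (x - y)‖ := by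
    intro t ht s hs
    have h1 := hpert s hs
    have h2 : ‖t • v‖ = t * ‖v‖ := by
      rw [norm_smul, Real.norm_of_nonneg (by linarith [ht.1])]
    have h3 : 3 / 4 * ‖v‖ ≤ t * ‖v‖ := by gcongr; exact ht.1
    have h4 : t • v = ((y - x₀) + s • (x - y)) + (x₀ - b) - (y - b - t • v + s • (x - y)) := by
      rw [hsplit]; abel
    have h5 := norm_sub_le (((y - x₀) + s • (x - y)) + (x₀ - b))
      (y - b - t • v + s • (x - y))
    have h6 := norm_add_le ((y - x₀) + s • (x - y)) (x₀ - b)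
    rw [← h4, h2] at h5
    linarith
  have hlow_near : ∀ t ∈ Set.Icc (0 : ℝ) (0 + 1 / 4), ∀ s ∈ Set.Icc (0 : ℝ) 1,
      β - 1 / 4 * ‖v‖ - 5 * r ≤ ‖y - b - t • v + s • (x - y)‖ := by
    intro t ht s hs
    have h1 := hpert s hs
    have h2 : ‖t • v‖ = t * ‖v‖ := by
      rw [norm_smul, Real.norm_of_nonneg ht.1]
    have h3 : t * ‖v‖ ≤ 1 / 4 * ‖v‖ := by gcongr; linarith [ht.2]
    have h4 : x₀ - b = (y - b - t • v + s • (x - y)) - (((y - x₀) + s • (x - y)) - t • v) := by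
      rw [hsplit]; abel
    have h5 := norm_sub_le (y - b - t • v + s • (x - y)) (((y - x₀) + s • (x - y)) - t • v)
    have h6 := norm_sub_le ((y - x₀) + s • (x - y)) (t • v)
    rw [← h4] at h5
    linarith
  -- The scale `σ` of the arguments of `D²h` is `r` if `x₀ = b` and `β` otherwise. The quarter
  -- interval avoids the zero of the weight: near `t = 0` when `‖v‖ ≤ 2β`, near `t = 1` when `‖v‖`
  -- dominates `β`.
  obtain ⟨σ, hσ, hrσ, hβσ, t₀, ht₀, ht₁, hlow⟩ : ∃ σ : ℝ, 0 < σ ∧ 5 * r + β ≤ 5 * σ ∧ r ≤ σ ∧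
      ∃ t₀ : ℝ, 0 ≤ t₀ ∧ t₀ + 1 / 4 ≤ 1 ∧ ∀ t ∈ Set.Icc t₀ (t₀ + 1 / 4),
        ∀ s ∈ Set.Icc (0 : ℝ) 1, σ / 4 ≤ ‖y - b - t • v + s • (x - y)‖ := by
    rcases (norm_nonneg (x₀ - b)).eq_or_lt with h0 | h0
    · rw [← hβ] at h0
      refine ⟨r, hr, by linarith, le_rfl, 3 / 4, by norm_num, by norm_num, fun t ht s hs => ?_⟩
      refine le_trans ?_ (hlow_far t ht s hs)
      linarith
    · rw [← hβ] at h0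
      have hrβ := hr₀β h0
      refine ⟨β, h0, by linarith, by linarith, ?_⟩
      rcases le_total ‖v‖ (2 * β) with hv2 | hv2
      · refine ⟨0, le_rfl, by norm_num, fun t ht s hs => ?_⟩
        refine le_trans ?_ (hlow_near t ht s hs)
        linarith
      · refine ⟨3 / 4, by norm_num, by norm_num, fun t ht s hs => ?_⟩
        refine le_trans ?_ (hlow_far t ht s hs)
        linarith
  have hup : ∀ t ∈ Set.Icc (0 : ℝ) 1, ∀ s ∈ Set.Icc (0 : ℝ) 1,
      ‖y - b - t • (f y - b) + s • (x - y)‖ ≤ (5 + C) * σ := by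
    intro t ht s hs
    rw [hsplit]
    refine (norm_add_le _ _).trans ?_
    have h1 := hpert s hs
    have h2 := norm_sub_le (x₀ - b) (t • (f y - b))
    rw [norm_smul, Real.norm_of_nonneg ht.1] at h2
    have h3 : t * ‖f y - b‖ ≤ 1 * (C * σ) := by
      gcongr
      · exact ht.2
      · exact hyb.trans (by gcongr)
    linarith
  have hmain := hh.norm_mul_rpow_le_of_hMonotone hHess hl hL hδL hδ1 hr (by positivity)
    (by positivity) ht₀ ht₁ (hT x y ξ hξ (f y) hyT) (norm_pos_iff.1 hv') hd hlow hup
  -- Upper and lower weights live at the same scale, so `σ` cancels and `K₁` does not depend on it.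
  have hpow : ((5 + C) * σ) ^ (p - 2) = (4 * (5 + C)) ^ (p - 2) * (σ / 4) ^ (p - 2) := by
    rw [← Real.mul_rpow (by positivity) (by positivity)]
    congr 1; ring
  have hσp : 0 < (σ / 4) ^ (p - 2) := by positivity
  have hfin : l * ‖v‖ * (σ / 4) ^ (p - 2) ≤ l * (K₁ * r) * (σ / 4) ^ (p - 2) := by
    calc _ ≤ 16 * L * ‖f y - b‖ * ((5 + C) * σ) ^ (p - 2) := hmain
      _ ≤ 16 * L * (C * r) * ((5 + C) * σ) ^ (p - 2) := by gcongr
      _ = _ := by rw [hpow, hK₁]; field_simp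
  have := le_of_mul_le_mul_left (le_of_mul_le_mul_right hfin hσp) hl
  linarith

theorem lipschitz_at_of_memBigT {n : ℕ} {p : ℝ} {h : EuclideanSpace ℝ (Fin n) → ℝ}
    (hh : IsAdmissibleCost p h)
    {T : EuclideanSpace ℝ (Fin n) → Set (EuclideanSpace ℝ (Fin n))} (hT : HMonotone h T)
    {f : EuclideanSpace ℝ (Fin n) → EuclideanSpace ℝ (Fin n)} (hf : IsAESelection f T)
    (hfL : MemLpLoc (p - 1) f) {x₀ : EuclideanSpace ℝ (Fin n)} (hx₀ : MemBigT (p - 1) f x₀)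
    (hfx₀ : f x₀ ∈ T x₀) :
    ∃ K : ℝ, ∀ᶠ x in 𝓝 x₀, ∀ ξ ∈ T x, ‖ξ - f x₀‖ ≤ K * ‖x - x₀‖ := by
  obtain ⟨b, K, r₀, hr₀, hbound⟩ := exists_linear_bound_of_memBigT hh hT hf hfL hx₀
  have hsingle : ∀ ξ ∈ T x₀, ξ = b := by
    intro ξ hξ
    have hlim : Tendsto (fun r : ℝ => K * r) (𝓝[>] 0) (𝓝 0) := by
      simpa using ((continuous_const_mul K).tendsto 0).mono_left nhdsWithin_le_nhds
    have hle : ‖ξ - b‖ ≤ 0 := by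
      refine ge_of_tendsto hlim ?_
      filter_upwards [Ioo_mem_nhdsGT hr₀] with r hr
      exact hbound r hr.1 hr.2 x₀ (by simpa using hr.1.le) ξ hξ
    exact sub_eq_zero.1 (norm_le_zero_iff.1 hle)
  refine ⟨K, ?_⟩
  filter_upwards [Metric.ball_mem_nhds x₀ hr₀] with x hx ξ hξ
  rw [hsingle _ hfx₀]
  rcases eq_or_ne x x₀ with rfl | hne
  · simp [hsingle ξ hξ]
  · rw [Metric.mem_ball, dist_eq_norm] at hx
    exact hbound _ (norm_pos_iff.2 (sub_ne_zero.2 hne)) hx x le_rfl ξ hξ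

/-! ### Density points and the Stepanov argument -/

/-- With `ρ = ‖x - x₀‖` and `ε ≤ 1`, a ball of radius `ερ` about `x` missing `s` would remove the
fixed fraction `(ε/2)^n` of the ball of radius `2ρ` about `x₀`, contradicting density one. -/
theorem eventually_exists_mem_dist_le_of_density_one {n : ℕ} {s : Set (EuclideanSpace ℝ (Fin n))}
    {x₀ : EuclideanSpace ℝ (Fin n)}
    (hs : Tendsto (fun r => volume (s ∩ Metric.closedBall x₀ r) / volume (Metric.closedBall x₀ r))
      (𝓝[>] 0) (𝓝 1)) (hx₀ : x₀ ∈ s) {ε : ℝ} (hε : 0 < ε) :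
    ∀ᶠ x in 𝓝 x₀, ∃ y ∈ s, ‖x - y‖ ≤ ε * ‖x - x₀‖ := by
  wlog hε1 : ε ≤ 1 generalizing ε
  · filter_upwards [this one_pos le_rfl] with x ⟨y, hy, hxy⟩
    exact ⟨y, hy, hxy.trans (by gcongr; exact (not_le.1 hε1).le)⟩
  set η : ℝ≥0∞ := ENNReal.ofReal ((ε / 2) ^ n) with hη
  have hη0 : 0 < η := ENNReal.ofReal_pos.2 (by positivity)
  have h1 : (1 : ℝ≥0∞) - η < 1 := ENNReal.sub_lt_self ENNReal.one_ne_top one_ne_zero hη0.ne'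
  have h2 := hs.eventually (lt_mem_nhds h1)
  rw [eventually_nhdsWithin_iff, Metric.eventually_nhds_iff] at h2
  obtain ⟨r₀, hr₀, h2⟩ := h2
  filter_upwards [Metric.ball_mem_nhds x₀ (half_pos hr₀)] with x hx
  rcases eq_or_ne x x₀ with rfl | hne
  · exact ⟨x, hx₀, by simp⟩
  have hρ : 0 < ‖x - x₀‖ := norm_pos_iff.2 (sub_ne_zero.2 hne)
  set ρ := ‖x - x₀‖ with hρd
  rw [Metric.mem_ball, dist_eq_norm, ← hρd] at hx
  have h3 := h2 (y := 2 * ρ) (by rw [Real.dist_eq, sub_zero, abs_of_pos] <;> linarith)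
    (by simpa using hρ)
  by_contra! hcon
  set B := Metric.closedBall x₀ (2 * ρ)
  have hsub : s ∩ B ⊆ B \ Metric.ball x (ε * ρ) := by
    rintro y ⟨hys, hyB⟩
    refine ⟨hyB, fun hy => ?_⟩
    rw [Metric.mem_ball, dist_comm, dist_eq_norm] at hy
    exact absurd (hcon y hys) (not_lt.2 hy.le)
  have hballsub : Metric.ball x (ε * ρ) ⊆ B := by
    intro y hy
    rw [Metric.mem_ball] at hy
    rw [Metric.mem_closedBall]
    have : dist y x₀ ≤ dist y x + dist x x₀ := dist_triangle _ _ _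
    rw [dist_eq_norm x x₀, ← hρd] at this
    nlinarith
  have hB0 : volume B ≠ 0 := (Metric.measure_closedBall_pos volume x₀ (by positivity)).ne'
  have hBt : volume B ≠ ⊤ := measure_closedBall_lt_top.ne
  have hball : volume (Metric.ball x (ε * ρ)) = η * volume B := by
    rw [Measure.addHaar_ball_of_pos _ _ (by positivity : 0 < ε * ρ),
      Measure.addHaar_closedBall _ _ (by positivity : 0 ≤ 2 * ρ), ← mul_assoc, hη,
      ← ENNReal.ofReal_mul (by positivity), finrank_euclideanSpace_fin, ← mul_pow]
    congr 3; ring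
  have h4 : volume (s ∩ B) ≤ (1 - η) * volume B := by
    refine (measure_mono hsub).trans ?_
    rw [measure_sdiff hballsub measurableSet_ball.nullMeasurableSet
      measure_ball_lt_top.ne, hball, ENNReal.sub_mul (fun _ _ => hBt), one_mul]
  exact absurd h3 (not_lt.2 (ENNReal.div_le_of_le_mul h4))

/-- A Stepanov theorem for multivalued maps. -/
theorem ae_hasMultiDerivAt_of_lipschitz_at {n : ℕ}
    {T : EuclideanSpace ℝ (Fin n) → Set (EuclideanSpace ℝ (Fin n))}
    {f : EuclideanSpace ℝ (Fin n) → EuclideanSpace ℝ (Fin n)} (hf : IsAESelection f T)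
    {E : Set (EuclideanSpace ℝ (Fin n))}
    (hE : ∀ x₀ ∈ E, f x₀ ∈ T x₀ → ∃ K : ℝ, ∀ᶠ x in 𝓝 x₀, ∀ ξ ∈ T x,
      ‖ξ - f x₀‖ ≤ K * ‖x - x₀‖) :
    ∀ᵐ x₀, x₀ ∈ E → ∃ A : EuclideanSpace ℝ (Fin n) →L[ℝ] EuclideanSpace ℝ (Fin n),
      HasMultiDerivAt T (f x₀) A x₀ := by
  -- Points with a uniform Lipschitz constant and radius. Pieces of diameter below that radius make
  -- `f` Lipschitz, so Rademacher applies to an extension `g`.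
  let S : ℕ → Set (EuclideanSpace ℝ (Fin n)) := fun k =>
    {x₀ | f x₀ ∈ T x₀ ∧ ∀ x, ‖x - x₀‖ < 1 / ((k : ℝ) + 1) → ∀ ξ ∈ T x,
      ‖ξ - f x₀‖ ≤ k * ‖x - x₀‖}
  obtain ⟨D, hDc, hDd⟩ := TopologicalSpace.exists_countable_dense (EuclideanSpace ℝ (Fin n))
  let P : ℕ → EuclideanSpace ℝ (Fin n) → Set (EuclideanSpace ℝ (Fin n)) := fun k c =>
    S k ∩ Metric.ball c (1 / ((k : ℝ) + 1) / 2)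
  have key : ∀ k, ∀ c, ∀ᵐ x₀, x₀ ∈ P k c →
      ∃ A : EuclideanSpace ℝ (Fin n) →L[ℝ] EuclideanSpace ℝ (Fin n),
        HasMultiDerivAt T (f x₀) A x₀ := by
    intro k c
    have hlip : LipschitzOnWith (k : NNReal) f (P k c) := by
      refine LipschitzOnWith.of_dist_le_mul fun x hx y hy => ?_
      rw [dist_eq_norm, dist_eq_norm]
      have hxy : ‖x - y‖ < 1 / ((k : ℝ) + 1) := by
        rw [← dist_eq_norm]
        have := dist_triangle_right x y c
        have h1 := Metric.mem_ball.1 hx.2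
        have h2 := Metric.mem_ball.1 hy.2
        linarith
      simpa using hy.1.2 x hxy (f x) hx.1.1
    obtain ⟨g, hg, hfg⟩ := hlip.extend_finite_dimension
    filter_upwards [hg.ae_differentiableAt (μ := volume),
      ae_imp_of_ae_restrict (Besicovitch.ae_tendsto_measure_inter_div volume (P k c))]
      with x₀ hd hdens hx₀
    refine ⟨fderiv ℝ g x₀, ?_, ?_⟩
    · refine Set.eq_singleton_iff_unique_mem.2 ⟨hx₀.1.1, fun ξ hξ => ?_⟩
      have := hx₀.1.2 x₀ (by simp; positivity) ξ hξ
      simpa [sub_eq_zero] using this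
    · intro ε hε
      set A := fderiv ℝ g x₀
      set C : ℝ := k + ‖A‖ + 1
      have hC : 0 < C := by positivity
      obtain ⟨δ, hδ, hδ1, hδC⟩ : ∃ δ : ℝ, 0 < δ ∧ δ < 1 ∧ δ * C ≤ ε / 2 := by
        refine ⟨min (1 / 2) (ε / 2 / C), by positivity,
          (min_le_left _ _).trans_lt (by norm_num), ?_⟩
        calc _ ≤ ε / 2 / C * C := by gcongr; exact min_le_right _ _
          _ = _ := by field_simp
      have hlin := (hasFDerivAt_iff_isLittleO.1 hd.hasFDerivAt).def
        (c := ε / 4) (by positivity)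
      rw [Metric.eventually_nhds_iff] at hlin
      obtain ⟨r, hr, hlin⟩ := hlin
      -- An arbitrary `x` is replaced by a nearby `y` in the piece: the bound centred at `y`
      -- controls all of `T x`, and `f = g` at `y` and `x₀`.
      filter_upwards [eventually_exists_mem_dist_le_of_density_one (hdens hx₀) hx₀ hδ,
        Metric.ball_mem_nhds x₀ (half_pos hr),
        Metric.ball_mem_nhds x₀ (by positivity : 0 < 1 / ((k : ℝ) + 1))]
        with x ⟨y, hy, hxy⟩ hxr hxk ξ hξ
      rw [Metric.mem_ball, dist_eq_norm] at hxr hxk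
      set ρ := ‖x - x₀‖ with hρ
      have hρ0 : 0 ≤ ρ := norm_nonneg _
      have hxy' : ‖x - y‖ ≤ ρ := hxy.trans (by nlinarith)
      have hyx : ‖y - x₀‖ ≤ 2 * ρ := by
        have : y - x₀ = (x - x₀) - (x - y) := by abel
        rw [this]
        refine (norm_sub_le _ _).trans ?_
        linarith
      have h1 : ‖ξ - f y‖ ≤ k * (δ * ρ) := by
        refine (hy.1.2 x (hxy'.trans_lt hxk) ξ hξ).trans ?_
        gcongr
      have h2 : ‖g y - g x₀ - A (y - x₀)‖ ≤ ε / 4 * (2 * ρ) := by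
        refine (hlin (by rw [dist_eq_norm]; linarith)).trans ?_
        gcongr
      rw [← hfg hy, ← hfg hx₀] at h2
      have h3 : ‖A (y - x)‖ ≤ ‖A‖ * (δ * ρ) := by
        refine (A.le_opNorm _).trans ?_
        gcongr
        rwa [norm_sub_rev]
      have h4 : ξ - f x₀ - A (x - x₀) = (ξ - f y) + (f y - f x₀ - A (y - x₀)) + A (y - x) := by
        simp only [map_sub]; abel
      rw [h4]
      refine (norm_add₃_le).trans ?_
      have h5 : δ * C * ρ ≤ ε / 2 * ρ := by gcongr
      have h6 : δ * C * ρ = k * (δ * ρ) + ‖A‖ * (δ * ρ) + δ * ρ := by ring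
      have h7 : 0 ≤ δ * ρ := by positivity
      linarith
  have hall : ∀ᵐ x₀, ∀ k, ∀ c ∈ D, x₀ ∈ P k c →
      ∃ A : EuclideanSpace ℝ (Fin n) →L[ℝ] EuclideanSpace ℝ (Fin n),
        HasMultiDerivAt T (f x₀) A x₀ :=
    ae_all_iff.2 fun k => (ae_ball_iff hDc).2 fun c _ => key k c
  filter_upwards [hall, hf] with x₀ h1 h2 hx₀
  obtain ⟨K, hK⟩ := hE x₀ hx₀ h2
  obtain ⟨r, hr, hK⟩ := Metric.eventually_nhds_iff.1 hK
  obtain ⟨k₁, hk₁⟩ := exists_nat_one_div_lt hr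
  obtain ⟨k₂, hk₂⟩ := exists_nat_ge K
  set k := max k₁ k₂
  have hk : 1 / ((k : ℝ) + 1) ≤ 1 / ((k₁ : ℝ) + 1) := by
    gcongr; exact le_max_left _ _
  obtain ⟨c, hc, hcD⟩ := hDd.exists_dist_lt x₀ (by positivity : 0 < 1 / ((k : ℝ) + 1) / 2)
  refine h1 k c hc ⟨⟨h2, fun x hx ξ hξ => ?_⟩, hcD⟩
  refine (hK (by rw [dist_eq_norm]; linarith) ξ hξ).trans ?_
  gcongr
  exact hk₂.trans (by exact_mod_cast le_max_right _ _)

theorem HasMultiDerivAt.hasLInftyDerivAt {n : ℕ}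
    {T : EuclideanSpace ℝ (Fin n) → Set (EuclideanSpace ℝ (Fin n))}
    {f : EuclideanSpace ℝ (Fin n) → EuclideanSpace ℝ (Fin n)} (hf : IsAESelection f T)
    {A : EuclideanSpace ℝ (Fin n) →L[ℝ] EuclideanSpace ℝ (Fin n)}
    {x₀ : EuclideanSpace ℝ (Fin n)} (h : HasMultiDerivAt T (f x₀) A x₀) :
    HasLInftyDerivAt f A x₀ := by
  intro ε hε
  obtain ⟨r, hr, h1⟩ := Metric.eventually_nhds_iff.1 (h.2 ε hε)
  filter_upwards [Ioo_mem_nhdsGT hr] with R hR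
  rw [eLpNorm_exponent_top]
  refine eLpNormEssSup_le_of_ae_bound ?_
  filter_upwards [ae_restrict_of_ae hf,
    ae_restrict_mem (measurableSet_ball (x := x₀) (ε := R))] with x hx hxR
  rw [Metric.mem_ball] at hxR
  have h2 := h1 (hxR.trans hR.2) (f x) hx
  rw [sub_right_comm]
  refine h2.trans ?_
  rw [dist_eq_norm] at hxR
  gcongr

theorem mainTheorem3 {n : ℕ} {p : ℝ} {h : EuclideanSpace ℝ (Fin n) → ℝ}
    (hh : IsAdmissibleCost p h)
    (T : EuclideanSpace ℝ (Fin n) → Set (EuclideanSpace ℝ (Fin n))) (hT : HMonotone h T)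
    (f : EuclideanSpace ℝ (Fin n) → EuclideanSpace ℝ (Fin n)) (hf : IsAESelection f T)
    (hfL : MemLpLoc (p - 1) f)
    (E : Set (EuclideanSpace ℝ (Fin n))) (hE : MeasurableSet E)
    (hfE : ∀ x₀ ∈ E, MemBigT (p - 1) f x₀) :
    ∀ᵐ x₀, x₀ ∈ E →
      ∃ A : EuclideanSpace ℝ (Fin n) →L[ℝ] EuclideanSpace ℝ (Fin n),
        HasLInftyDerivAt f A x₀ ∧ HasMultiDerivAt T (f x₀) A x₀ := by
  filter_upwards [ae_hasMultiDerivAt_of_lipschitz_at hf fun x₀ hx₀ hfx₀ =>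
    lipschitz_at_of_memBigT hh hT hf hfL (hfE x₀ hx₀) hfx₀] with x₀ h₀ hx₀
  obtain ⟨A, hA⟩ := h₀ hx₀
  exact ⟨A, hA.hasLInftyDerivAt hf, hA⟩
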